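/- Let $d$ be a prime, $\omega = e^{2\pi i/d}$ and $\tau = e^{\pi i (d^2+1)/d}$ (so $\tau^2=\omega$). For $n\ge 1$ let $V=\mathbb{Z}_d^n\times\mathbb{Z}_d^n$ carry the symplectic form $[u,v]=u_p\cdot v_q-u_q\cdot v_p$, where $u=(u_p,u_q)$, $v=(v_p,v_q)$. On $\mathbb{C}^d$ with orthonormal basis $\{|x\rangle : x\in\mathbb{Z}_d\}$ put $\hat x(q)|x\rangle=|x+q\rangle$, $\hat z(p)|x\rangle=\omega^{px}|x\rangle$ and $w(p,q)=\tau^{-pq}\hat z(p)\hat x(q)$, where $p,q$ in the exponent of $\tau$ are the integer representatives in $\{0,\dots,d-1\}$; on $(\mathbb{C}^d)^{\otimes n}$ put $w(v)=w(p_1,q_1)\otimes\cdots\otimes w(p_n,q_n)$ for $v=(p,q)\in V$. A subspace $M\subseteq V$ is Lagrangian if $M=\{v\in V : [v,m]=0 \ \forall m\in M\}$. For a basis $\mathcal{B}=(u_1,\dots,u_r)$ of a Lagrangian subspace $M$ and $m=\sum_i m_iu_i$, $m_i\in\{0,\dots,d-1\}$, put $w_{\mathcal{B}}(m)=\prod_i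 w(u_i)^{m_i}$. A stabilizer state is a unit vector $\psi\in(\mathbb{C}^d)^{\otimes n}$, taken up to a global phase, for which there are a Lagrangian subspace $M$, a basis $\mathcal{B}$ of $M$ and $v\in V$ with $\omega^{[v,m]}w_{\mathcal{B}}(m)\psi=\psi$ for all $m\in M$. Let $\operatorname{Stabs}(d,n)$ be the set of all stabilizer states, and for a finite non-empty set $S$ of unit vectors up to phase and an integer $t\ge 1$ define the $t$-th frame potential $$\mathcal{F}_t(S)=\frac{1}{|S|^2}\sum_{x,y\in S}|\langle x,y\rangle|^{2t}.$$ **Theorem.** Let $d$ be a prime and $t\ge 1$ an integer. Then $\operatorname{Stabs}(d,n)$ is finite and non-empty for every $n\ge 1$, and its $t$-th frame potential is determined by $$\mathcal{F}_t(\operatorname{Stabs}(d,1))=\frac{d^{2-t}+1}{(d+1)d},\qquad \frac{\mathcal{F}_t(\operatorname{Stabs}(d,n+1))}{\mathcal{F}_t(\operatorname{Stabs}(d,n))}=\frac{d^{\,n-(t-2)}+1}{d\,(d^{\,n+1}+1)}\quad\text{for all } n\ge 1.$$ -/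

import Mathlib

open scoped Matrix LinearAlgebra.Projectivization

noncomputable section

namespace StabilizerStates

/-- The configuration space `Q = ℤ_d^n`. -/
abbrev Config (d n : ℕ) : Type := Fin n → ZMod d

/-- The phase space `V = Q × Q`, with elements `v = (v_p, v_q)`. -/
abbrev PhaseSpace (d n : ℕ) : Type := Config d n × Config d n

/-- The Hilbert space `(ℂ^d)^{⊗ n}`, written in the product basis `|x₁⟩ ⊗ ⋯ ⊗ |xₙ⟩`, which is
indexed by `x ∈ ℤ_d^n`, with its standard inner product. -/
abbrev Hilb (d n : ℕ) [NeZero d] : Type := EuclideanSpace ℂ (Config d n)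

/-- The phase `τ = exp(π i (d² + 1) / d)`. -/
def tau (d : ℕ) : ℂ := Complex.exp (Real.pi * Complex.I * ((d : ℂ) ^ 2 + 1) / d)

/-- The phase `ω = τ² = exp(2 π i / d)`. -/
def omega (d : ℕ) : ℂ := tau d ^ 2

/-- The shift operator `x̂(q) |x⟩ = |x + q⟩` on `ℂ^d`, as a matrix. -/
def shift (d : ℕ) (q : ZMod d) : Matrix (ZMod d) (ZMod d) ℂ :=
  Matrix.of fun y x => if y = x + q then 1 else 0

/-- The boost operator `ẑ(p) |x⟩ = ω^{p x} |x⟩` on `ℂ^d`, as a matrix. -/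
def boost (d : ℕ) (p : ZMod d) : Matrix (ZMod d) (ZMod d) ℂ :=
  Matrix.diagonal fun x => omega d ^ (p.val * x.val)

/-- The Weyl operator `w(p, q) = τ^{-pq} ẑ(p) x̂(q)` of one `d`-level system. The exponent of `τ`
is the integer `-pq`, where `p, q ∈ {0, …, d - 1}`. -/
def weylOne (d : ℕ) [NeZero d] (p q : ZMod d) : Matrix (ZMod d) (ZMod d) ℂ :=
  (tau d ^ (-((p.val : ℤ) * (q.val : ℤ)))) • (boost d p * shift d q)

/-- The Weyl operator `w(v) = w(p₁, q₁) ⊗ ⋯ ⊗ w(pₙ, qₙ)` for `v = (p, q)`: the matrix of the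
tensor product in the product basis. -/
def weyl (d n : ℕ) [NeZero d] (v : PhaseSpace d n) : Matrix (Config d n) (Config d n) ℂ :=
  Matrix.of fun y x => ∏ i, weylOne d (v.1 i) (v.2 i) (y i) (x i)

/-- The symplectic form `[u, v] = u_p · v_q - u_q · v_p`. -/
def symp {d n : ℕ} (u v : PhaseSpace d n) : ZMod d := u.1 ⬝ᵥ v.2 - u.2 ⬝ᵥ v.1

/-- `M` is Lagrangian: it equals its symplectic complement. -/
def IsLagrangian {d n : ℕ} (M : Submodule (ZMod d) (PhaseSpace d n)) : Prop :=
  ∀ v : PhaseSpace d n, v ∈ M ↔ ∀ m ∈ M, symp v m = 0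

/-- For a basis `B = (u₁, …, u_r)` of `M` and `m = ∑ mᵢ uᵢ`, the operator
`w_B(m) = w(u₁)^{m₁} ⋯ w(u_r)^{m_r}`. -/
def weylBasis {d n r : ℕ} [NeZero d] {M : Submodule (ZMod d) (PhaseSpace d n)}
    (B : Module.Basis (Fin r) (ZMod d) M) (m : M) : Matrix (Config d n) (Config d n) ℂ :=
  (List.ofFn fun i : Fin r => weyl d n (B i : PhaseSpace d n) ^ (B.repr m i).val).prod

/-- `ψ` is a stabilizer state vector: a unit vector such that, for some Lagrangian subspace `M`,
some basis `B` of `M` and some `v ∈ V`, one has `ω^{[v, m]} w_B(m) ψ = ψ` for all `m ∈ M`. -/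
def IsStabilizerVector (d n : ℕ) [NeZero d] (ψ : Hilb d n) : Prop :=
  ‖ψ‖ = 1 ∧
    ∃ (M : Submodule (ZMod d) (PhaseSpace d n)) (r : ℕ) (B : Module.Basis (Fin r) (ZMod d) M)
      (v : PhaseSpace d n), IsLagrangian M ∧
        ∀ m : M, omega d ^ (symp v (m : PhaseSpace d n)).val • (weylBasis B m *ᵥ ψ.ofLp) = ψ.ofLp

/-- The set `Stabs(d, n)` of stabilizer states. A state is a unit vector up to a global phase,
that is, a point of the projective space of the Hilbert space. -/
def Stabs (d n : ℕ) [NeZero d] : Set (ℙ ℂ (Hilb d n)) :=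
  {x | ∃ (ψ : Hilb d n) (hψ : ψ ≠ 0), IsStabilizerVector d n ψ ∧ x = Projectivization.mk ℂ ψ hψ}

/-- The overlap `|⟨x, y⟩|` of two states, computed from unit vectors that represent them. -/
def overlap {E : Type*} [NormedAddCommGroup E] [InnerProductSpace ℂ E] (x y : ℙ ℂ E) : ℝ :=
  ‖inner ℂ ((‖x.rep‖⁻¹ : ℂ) • x.rep) ((‖y.rep‖⁻¹ : ℂ) • y.rep)‖

/-- The `t`-th frame potential of (the uniform distribution on) a finite set `S` of states:
`|S|⁻² ∑_{x, y ∈ S} |⟨x, y⟩|^{2t}`. -/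
def framePotential {E : Type*} [NormedAddCommGroup E] [InnerProductSpace ℂ E]
    (t : ℕ) (S : Set (ℙ ℂ E)) : ℝ :=
  ((S.ncard : ℝ) ^ 2)⁻¹ * ∑ᶠ (x ∈ S) (y ∈ S), overlap x y ^ (2 * t)

end StabilizerStates

end

/-!
A unit vector is a stabilizer vector exactly if it is a joint eigenvector of the Weyl operators of
some Lagrangian subspace `M` (`isStabilizerVector_iff`), and `M` is then determined by the state
(`IsLagrangian.eq_isotropy`). It is convenient to drop the power of `τ` from the Weyl operators:
the remaining `displacement` operators have the same eigenvectors, and their phases are values of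
the standard additive character of `ℤ_d`, also for `d = 2`.

The Weyl operators of `M` commute and have finite order, so the states belonging to `M` form an
orthonormal basis (`span_unitRep_eigenstates`, `overlap_eq_zero_of_ne`). The displacement operators
form an orthogonal operator basis (`sum_inner_displacement`), so that the squared overlap of a state
of `M` with a state of `N` is `d^{-n}` times the sum of a character over `M ∩ N`: it is `0` or
`|M ∩ N| / d^n` (`overlap_sq`). Since the squared overlaps with an orthonormal basis sum to `1`, the
sum of the overlaps to the power `2t` over the states of `N` is `(|M ∩ N| / d^n)^(t-1)`
(`sum_overlap_pow`).

It remains to sum `|M ∩ N|^s` over all Lagrangian subspaces `N` of a symplectic space of dimension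
`2n` over a field with `q` elements, for a fixed `M`. The value is `∏ i ∈ {1, …, n}, (q^s + q^i)`
(`sum_card_inf_pow`), by induction on `n`. Take a hyperbolic pair `(w, e)` with `e ∈ M`, and let `K'`
be the orthogonal complement of its plane. The Lagrangian subspaces through `e`, and likewise those
through `w`, correspond to those of `K'`; the intersection with `M` is that with `M ∩ K'`, enlarged
by the factor `q` in the first case. A Lagrangian subspace that avoids `e` contains `q^(n-1)` of the
`q^(2n-1)` vectors `w` with `[w, e] = 1`, which yields the recursion factor `q^s + q^n`. The exponent
`s = 0` counts the Lagrangian subspaces.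
-/

noncomputable section

namespace StabilizerStates

/-! ### Counting Lagrangian subspaces by their intersection with a given one -/

section Lagrangian

variable {F V : Type*} [Field F] [AddCommGroup V] [Module F V]

/-- `N` is a Lagrangian subspace of the subspace `K` for the form `B`: it is its own orthogonal
complement within `K`. -/
def IsLagrangianIn (B : V →ₗ[F] V →ₗ[F] F) (K N : Submodule F V) : Prop :=
  ∀ v, v ∈ N ↔ v ∈ K ∧ ∀ m ∈ N, B v m = 0

/-- The restriction of the form `B` to the subspace `K` is nondegenerate. -/
def IsNondegenerateOn (B : V →ₗ[F] V →ₗ[F] F) (K : Submodule F V) : Prop :=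
  ∀ v ∈ K, (∀ u ∈ K, B v u = 0) → v = 0

/-- The orthogonal complement within `K` of the plane spanned by `e` and `w`. -/
def planeComplement (B : V →ₗ[F] V →ₗ[F] F) (K : Submodule F V) (e w : V) : Submodule F V :=
  K ⊓ (LinearMap.ker (B e) ⊓ LinearMap.ker (B w))

variable {B : V →ₗ[F] V →ₗ[F] F} {K M N P A : Submodule F V} {e w : V}

lemma mem_planeComplement {v : V} :
    v ∈ planeComplement B K e w ↔ v ∈ K ∧ B e v = 0 ∧ B w v = 0 := by
  simp [planeComplement]

lemma planeComplement_comm : planeComplement B K e w = planeComplement B K w e := by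
  ext v; simp only [mem_planeComplement]; tauto

lemma card_eq_card_mul_card_inf_ker (f : V →ₗ[F] F) (he : e ∈ A) (hf : f e = 1) :
    Nat.card A = Nat.card F * Nat.card (A ⊓ LinearMap.ker f : Submodule F V) := by
  rw [← Nat.card_prod]
  refine Nat.card_congr
    { toFun := fun a => (f a, ⟨a - f a • e, A.sub_mem a.2 (A.smul_mem _ he), by simp [hf]⟩)
      invFun := fun p => ⟨p.2 + p.1 • e, A.add_mem p.2.2.1 (A.smul_mem _ he)⟩
      left_inv := fun a => by simp
      right_inv := fun p => ?_ }
  have h : f p.2 = 0 := p.2.2.2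
  ext <;> simp [h, hf]

lemma card_level_one (f : V →ₗ[F] F) (he : e ∈ A) (hf : f e = 1) :
    Nat.card {a // a ∈ A ∧ f a = 1} = Nat.card (A ⊓ LinearMap.ker f : Submodule F V) := by
  refine Nat.card_congr
    { toFun := fun a => ⟨a - e, A.sub_mem a.2.1 he, by simp [hf, a.2.2]⟩
      invFun := fun p => ⟨p + e, A.add_mem p.2.1 he, by
        have h : f p = 0 := p.2.2
        simp [h, hf]⟩
      left_inv := fun a => by simp
      right_inv := fun p => by simp }

lemma IsNondegenerateOn.exists_eq_one (hK : IsNondegenerateOn B K) (hB : B.IsAlt)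
    (he : e ∈ K) (h0 : e ≠ 0) : ∃ w ∈ K, B w e = 1 := by
  by_contra! h
  refine h0 (hK e he fun u hu => ?_)
  by_contra hne
  refine h (-(B e u)⁻¹ • u) (K.smul_mem _ hu) ?_
  rw [map_smul, LinearMap.smul_apply, smul_eq_mul, ← hB.neg u e]
  simp
  have : B u e ≠ 0 := fun h => hne (by rw [← hB.neg u e, h, neg_zero])
  field_simp

/-- Splitting a vector of `K` along a hyperbolic pair. -/
lemma exists_decomposition (hB : B.IsAlt) (he : e ∈ K) (hw : w ∈ K) (hwe : B w e = 1)
    {v : V} (hv : v ∈ K) :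
    v + B e v • w - B w v • e ∈ planeComplement B K e w := by
  have hew : B e w = -1 := by rw [← hB.neg w e, hwe]
  refine mem_planeComplement.2 ⟨K.sub_mem (K.add_mem hv (K.smul_mem _ hw)) (K.smul_mem _ he), ?_, ?_⟩
  · simp [hew, hB.self_eq_zero]
  · simp [hwe, hB.self_eq_zero]

lemma IsNondegenerateOn.planeComplement (hK : IsNondegenerateOn B K) (hB : B.IsAlt)
    (he : e ∈ K) (hw : w ∈ K) (hwe : B w e = 1) :
    IsNondegenerateOn B (planeComplement B K e w) := by
  intro v hv h
  obtain ⟨hvK, hev, hwv⟩ := mem_planeComplement.1 hv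
  refine hK v hvK fun u hu => ?_
  have := h _ (exists_decomposition hB he hw hwe hu)
  have h1 : B v e = 0 := by rw [← hB.neg e v, hev, neg_zero]
  have h2 : B v w = 0 := by rw [← hB.neg w v, hwv, neg_zero]
  simpa [h1, h2] using this

lemma card_eq_sq_mul_card_planeComplement (hB : B.IsAlt) (he : e ∈ K) (hw : w ∈ K)
    (hwe : B w e = 1) :
    Nat.card K = Nat.card F ^ 2 * Nat.card (planeComplement B K e w) := by
  have hew : B e w = -1 := by rw [← hB.neg w e, hwe]
  rw [card_eq_card_mul_card_inf_ker (B w) he hwe,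
    card_eq_card_mul_card_inf_ker (A := K ⊓ LinearMap.ker (B w)) (B e) (e := -w)
      ⟨K.neg_mem hw, by simp [hB.self_eq_zero]⟩ (by simp [hew]),
    ← mul_assoc, ← sq, StabilizerStates.planeComplement, inf_assoc, inf_comm (LinearMap.ker (B e))]

lemma IsLagrangianIn.le (h : IsLagrangianIn B K N) : N ≤ K := fun v hv => ((h v).1 hv).1

lemma IsLagrangianIn.apply_eq_zero (h : IsLagrangianIn B K N) {u v : V} (hu : u ∈ N)
    (hv : v ∈ N) : B u v = 0 := ((h u).1 hu).2 v hv

/-- The condition `B e w ≠ 0` is symmetric in `e` and `w`, so that the lemma serves both vectors of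
a hyperbolic pair. -/
lemma IsLagrangianIn.sup_span (hP : IsLagrangianIn B (planeComplement B K e w) P)
    (hB : B.IsAlt) (he : e ∈ K) (hew : B e w ≠ 0) : IsLagrangianIn B K (P ⊔ F ∙ e) := by
  have hPe : ∀ p ∈ P, B e p = 0 := fun p hp => (mem_planeComplement.1 (hP.le hp)).2.1
  have hPe' : ∀ p ∈ P, B p e = 0 := fun p hp => by rw [← hB.neg e p, hPe p hp, neg_zero]
  have hPw : ∀ p ∈ P, B w p = 0 := fun p hp => (mem_planeComplement.1 (hP.le hp)).2.2
  have hwe : B w e ≠ 0 := fun h => hew (by rw [← hB.neg w e, h, neg_zero])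
  intro v
  constructor
  · intro hv
    obtain ⟨p, hp, x, hx, rfl⟩ := Submodule.mem_sup.1 hv
    obtain ⟨a, rfl⟩ := Submodule.mem_span_singleton.1 hx
    refine ⟨K.add_mem (mem_planeComplement.1 (hP.le hp)).1 (K.smul_mem _ he), fun m hm => ?_⟩
    obtain ⟨p', hp', x', hx', rfl⟩ := Submodule.mem_sup.1 hm
    obtain ⟨a', rfl⟩ := Submodule.mem_span_singleton.1 hx'
    simp [hP.apply_eq_zero hp hp', hPe p' hp', hPe' p hp, hB.self_eq_zero]
  · rintro ⟨hvK, hv⟩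
    have hve : B v e = 0 := hv e (Submodule.mem_sup_right (Submodule.mem_span_singleton_self e))
    have hev : B e v = 0 := by rw [← hB.neg v e, hve, neg_zero]
    have key : v - (B w v / B w e) • e ∈ P := by
      refine (hP _).2 ⟨mem_planeComplement.2
        ⟨K.sub_mem hvK (K.smul_mem _ he), by simp [hev, hB.self_eq_zero], by simp [hwe]⟩,
        fun p hp => ?_⟩
      simp [hv p (Submodule.mem_sup_left hp), hPe p hp]
    rw [← sub_add_cancel v ((B w v / B w e) • e)]
    exact add_mem (Submodule.mem_sup_left key)
      (Submodule.mem_sup_right (Submodule.smul_mem _ _ (Submodule.mem_span_singleton_self e)))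

lemma IsLagrangianIn.inf_planeComplement_sup_span (hN : IsLagrangianIn B K N) (hB : B.IsAlt)
    (he : e ∈ N) (hew : B e w ≠ 0) : N ⊓ planeComplement B K e w ⊔ F ∙ e = N := by
  have hwe : B w e ≠ 0 := fun h => hew (by rw [← hB.neg w e, h, neg_zero])
  refine le_antisymm (sup_le inf_le_left (by simpa using he)) fun v hv => ?_
  rw [← sub_add_cancel v ((B w v / B w e) • e)]
  refine add_mem (Submodule.mem_sup_left ⟨N.sub_mem hv (N.smul_mem _ he),
    mem_planeComplement.2 ⟨hN.le (N.sub_mem hv (N.smul_mem _ he)), ?_, by simp [hwe]⟩⟩)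
    (Submodule.mem_sup_right (Submodule.smul_mem _ _ (Submodule.mem_span_singleton_self e)))
  simp [hN.apply_eq_zero he hv, hB.self_eq_zero]

lemma IsLagrangianIn.inf_planeComplement (hN : IsLagrangianIn B K N) (hB : B.IsAlt)
    (he : e ∈ N) (hew : B e w ≠ 0) :
    IsLagrangianIn B (planeComplement B K e w) (N ⊓ planeComplement B K e w) := by
  intro v
  constructor
  · rintro ⟨hv, hv'⟩
    exact ⟨hv', fun m hm => hN.apply_eq_zero hv hm.1⟩
  · rintro ⟨hv, h⟩
    obtain ⟨hvK, hev, hwv⟩ := mem_planeComplement.1 hv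
    refine ⟨(hN v).2 ⟨hvK, fun m hm => ?_⟩, hv⟩
    rw [← hN.inf_planeComplement_sup_span hB he hew] at hm
    obtain ⟨p, hp, x, hx, rfl⟩ := Submodule.mem_sup.1 hm
    obtain ⟨a, rfl⟩ := Submodule.mem_span_singleton.1 hx
    have hve : B v e = 0 := by rw [← hB.neg e v, hev, neg_zero]
    simp [h p hp, hve]

lemma sup_span_inf_planeComplement (hP : P ≤ planeComplement B K e w) (hB : B.IsAlt)
    (hew : B e w ≠ 0) : (P ⊔ F ∙ e) ⊓ planeComplement B K e w = P := by
  have hwe : B w e ≠ 0 := fun h => hew (by rw [← hB.neg w e, h, neg_zero])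
  refine le_antisymm ?_ (le_inf le_sup_left hP)
  rintro v ⟨hv, hv'⟩
  obtain ⟨p, hp, x, hx, rfl⟩ := Submodule.mem_sup.1 hv
  obtain ⟨a, rfl⟩ := Submodule.mem_span_singleton.1 hx
  have h := (mem_planeComplement.1 hv').2.2
  have ha : a = 0 := by simpa [(mem_planeComplement.1 (hP hp)).2.2, hwe] using h
  simpa [ha] using hp

lemma card_inf_sup_span (hB : B.IsAlt) (he : e ∈ M)
    (hwe : B w e = 1) (hP : P ≤ planeComplement B K e w) :
    Nat.card (M ⊓ (P ⊔ F ∙ e) : Submodule F V) =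
      Nat.card F * Nat.card (M ⊓ planeComplement B K e w ⊓ P : Submodule F V) := by
  have hew : B e w ≠ 0 := by rw [← hB.neg w e, hwe]; simp
  rw [card_eq_card_mul_card_inf_ker (A := M ⊓ (P ⊔ F ∙ e)) (B w) (e := e)
    ⟨he, Submodule.mem_sup_right (Submodule.mem_span_singleton_self e)⟩ hwe]
  have hker : (P ⊔ F ∙ e) ⊓ LinearMap.ker (B w) = P := by
    refine le_antisymm ?_ (le_inf le_sup_left fun p hp => (mem_planeComplement.1 (hP hp)).2.2)
    rintro v ⟨hv, hv'⟩
    obtain ⟨p, hp, x, hx, rfl⟩ := Submodule.mem_sup.1 hv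
    obtain ⟨a, rfl⟩ := Submodule.mem_span_singleton.1 hx
    have h : B w (p + a • e) = 0 := hv'
    have ha : a = 0 := by simpa [(mem_planeComplement.1 (hP hp)).2.2, hwe] using h
    simpa [ha] using hp
  rw [inf_assoc, hker, inf_assoc, inf_eq_right.2 hP]

lemma inf_sup_span_of_mem (hM : IsLagrangianIn B K M) (he : e ∈ M)
    (hew : B e w ≠ 0) (hP : P ≤ planeComplement B K e w) :
    M ⊓ (P ⊔ F ∙ w) = M ⊓ planeComplement B K e w ⊓ P := by
  rw [inf_assoc, inf_eq_right.2 hP]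
  refine le_antisymm ?_ (inf_le_inf_left _ le_sup_left)
  rintro v ⟨hvM, hv⟩
  refine ⟨hvM, ?_⟩
  obtain ⟨p, hp, x, hx, rfl⟩ := Submodule.mem_sup.1 hv
  obtain ⟨a, rfl⟩ := Submodule.mem_span_singleton.1 hx
  have ha : a = 0 := by
    simpa [(mem_planeComplement.1 (hP hp)).2.1, hew] using hM.apply_eq_zero he hvM
  simpa [ha] using hp

section Finite

variable [Finite V]

/-- The finite set of Lagrangian subspaces of `K`. -/
def lagrangians (B : V →ₗ[F] V →ₗ[F] F) (K : Submodule F V) : Finset (Submodule F V) :=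
  (Set.toFinite {N | IsLagrangianIn B K N}).toFinset

lemma mem_lagrangians : N ∈ lagrangians B K ↔ IsLagrangianIn B K N := by
  simp [lagrangians]

/-- The sum over the Lagrangian subspaces of `K` through a vector `e` of a hyperbolic pair, as a sum
over the Lagrangian subspaces of the complement of the pair. -/
lemma sum_lagrangians_through (hB : B.IsAlt) (he : e ∈ K) (hew : B e w ≠ 0)
    (g : Submodule F V → ℕ) [DecidablePred fun N : Submodule F V => e ∈ N] :
    ∑ N ∈ lagrangians B K with e ∈ N, g N =
      ∑ P ∈ lagrangians B (planeComplement B K e w), g (P ⊔ F ∙ e) := by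
  refine Finset.sum_nbij' (fun N => N ⊓ planeComplement B K e w) (fun P => P ⊔ F ∙ e) ?_ ?_ ?_ ?_ ?_
  · intro N hN
    obtain ⟨hN, heN⟩ := Finset.mem_filter.1 hN
    exact mem_lagrangians.2 ((mem_lagrangians.1 hN).inf_planeComplement hB heN hew)
  · intro P hP
    exact Finset.mem_filter.2 ⟨mem_lagrangians.2 ((mem_lagrangians.1 hP).sup_span hB he hew),
      Submodule.mem_sup_right (Submodule.mem_span_singleton_self e)⟩
  · intro N hN
    obtain ⟨hN, heN⟩ := Finset.mem_filter.1 hN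
    exact (mem_lagrangians.1 hN).inf_planeComplement_sup_span hB heN hew
  · intro P hP
    exact sup_span_inf_planeComplement (mem_lagrangians.1 hP).le hB hew
  · intro N hN
    obtain ⟨hN, heN⟩ := Finset.mem_filter.1 hN
    rw [(mem_lagrangians.1 hN).inf_planeComplement_sup_span hB heN hew]

end Finite

variable [Finite F]

lemma exists_mem_ne_zero (hN : IsLagrangianIn B K N) {n : ℕ}
    (hn : Nat.card K = Nat.card F ^ (2 * (n + 1))) : ∃ e ∈ N, e ≠ 0 := by
  by_contra! h
  have h1 : K = ⊥ := by
    refine (Submodule.eq_bot_iff _).2 fun v hv => h v ((hN v).2 ⟨hv, fun m hm => ?_⟩)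
    rw [h m hm, map_zero]
  rw [h1] at hn
  have : 1 < Nat.card F ^ (2 * (n + 1)) := Nat.one_lt_pow (by omega) Finite.one_lt_card
  simp at hn
  omega

/-- A Lagrangian subspace has half the dimension of the whole. -/
lemma IsLagrangianIn.card_eq (hB : B.IsAlt) {n : ℕ} (hK : IsNondegenerateOn B K)
    (hn : Nat.card K = Nat.card F ^ (2 * n)) (hN : IsLagrangianIn B K N) :
    Nat.card N = Nat.card F ^ n := by
  induction n generalizing K N with
  | zero =>
    have : K = ⊥ := by
      rw [Submodule.eq_bot_iff]
      intro v hv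
      have : Subsingleton K := (Nat.card_eq_one_iff_unique.1 (by simpa using hn)).1
      simpa using congrArg Subtype.val (Subsingleton.elim (⟨v, hv⟩ : K) 0)
    have : N = ⊥ := le_bot_iff.1 (this ▸ hN.le)
    subst this
    simp
  | succ n ih =>
    obtain ⟨e, he, h0⟩ := exists_mem_ne_zero hN hn
    obtain ⟨w, hw, hwe⟩ := hK.exists_eq_one hB (hN.le he) h0
    have hew : B e w ≠ 0 := by rw [← hB.neg w e, hwe]; simp
    have hq : 0 < Nat.card F := Nat.card_pos
    have h1 := card_eq_sq_mul_card_planeComplement hB (hN.le he) hw hwe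
    have h2 : Nat.card (planeComplement B K e w) = Nat.card F ^ (2 * n) := by
      rw [hn] at h1
      refine (Nat.eq_of_mul_eq_mul_left (pow_pos hq 2) ?_).symm
      rw [← h1]; ring
    have h3 := ih (hK.planeComplement hB (hN.le he) hw hwe) h2 (hN.inf_planeComplement hB he hew)
    have h4 := card_inf_sup_span hB he hwe
      (inf_le_right : N ⊓ planeComplement B K e w ≤ planeComplement B K e w)
    rw [hN.inf_planeComplement_sup_span hB he hew, inf_idem, inf_idem, h3] at h4
    rw [h4, pow_succ']

variable [Finite V]

open Classical in
/-- The `s`-th moment of `|M ∩ N|` over all Lagrangian subspaces `N`. The Lagrangian subspaces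
through a nonzero `e ∈ M` correspond to those of the complement of a hyperbolic pair `(w, e)`, and
so do those through `w`; averaging the latter over all `w` with `B w e = 1` accounts for the
Lagrangian subspaces that avoid `e`. -/
theorem sum_card_inf_pow (hB : B.IsAlt) (s : ℕ) {n : ℕ} (hK : IsNondegenerateOn B K)
    (hn : Nat.card K = Nat.card F ^ (2 * n)) (hM : IsLagrangianIn B K M) :
    ∑ N ∈ lagrangians B K, Nat.card (M ⊓ N : Submodule F V) ^ s =
      ∏ i ∈ Finset.range n, (Nat.card F ^ s + Nat.card F ^ (i + 1)) := by
  induction n generalizing K M with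
  | zero =>
    have hbot : K = ⊥ := by
      rw [Submodule.eq_bot_iff]
      intro v hv
      have : Subsingleton K := (Nat.card_eq_one_iff_unique.1 (by simpa using hn)).1
      simpa using congrArg Subtype.val (Subsingleton.elim (⟨v, hv⟩ : K) 0)
    subst hbot
    have hM' : M = ⊥ := le_bot_iff.1 hM.le
    have : lagrangians B (⊥ : Submodule F V) = {⊥} := by
      ext N
      rw [mem_lagrangians, Finset.mem_singleton]
      exact ⟨fun h => le_bot_iff.1 h.le, fun h => by rw [h, ← hM']; rw [← hM'] at hM; exact hM⟩
    rw [this, Finset.sum_singleton, inf_bot_eq]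
    simp
  | succ n ih =>
    obtain ⟨e, he, h0⟩ := exists_mem_ne_zero hM hn
    have heK := hM.le he
    obtain ⟨w, hw, hwe⟩ := hK.exists_eq_one hB heK h0
    have hq : 0 < Nat.card F := Nat.card_pos
    have hcard : ∀ w ∈ K, B w e = 1 →
        Nat.card (planeComplement B K e w) = Nat.card F ^ (2 * n) := by
      intro w hw hwe
      have h1 := card_eq_sq_mul_card_planeComplement hB heK hw hwe
      rw [hn] at h1
      refine (Nat.eq_of_mul_eq_mul_left (pow_pos hq 2) ?_).symm
      rw [← h1]; ring
    have hne : ∀ w, B w e = 1 → B e w ≠ 0 := fun w hwe => by rw [← hB.neg w e, hwe]; simp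
    have hih : ∀ w ∈ K, B w e = 1 →
        ∑ P ∈ lagrangians B (planeComplement B K e w),
          Nat.card (M ⊓ planeComplement B K e w ⊓ P : Submodule F V) ^ s =
        ∏ i ∈ Finset.range n, (Nat.card F ^ s + Nat.card F ^ (i + 1)) := fun w hw hwe =>
      ih (hK.planeComplement hB heK hw hwe) (hcard w hw hwe)
        (hM.inf_planeComplement hB he (hne w hwe))
    rw [← Finset.sum_filter_add_sum_filter_not (lagrangians B K) (fun N => e ∈ N),
      Finset.prod_range_succ, mul_add]
    congr 1
    · rw [sum_lagrangians_through hB heK (hne w hwe), ← hih w hw hwe, Finset.sum_mul]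
      refine Finset.sum_congr rfl fun P hP => ?_
      rw [card_inf_sup_span hB he hwe (mem_lagrangians.1 hP).le, mul_pow, mul_comm]
    · -- Count the pairs `(N, w)` with `w ∈ N` and `B w e = 1`, first by `N` and then by `w`.
      have : Fintype V := Fintype.ofFinite V
      set W : Finset V := Finset.univ.filter fun w => w ∈ K ∧ B w e = 1 with hW
      have hlevel : ∀ A : Submodule F V, (∃ w ∈ A, B w e = 1) →
          (Finset.univ.filter fun w => w ∈ A ∧ B w e = 1).card * Nat.card F = Nat.card A := by
        rintro A ⟨w, hw, hwe⟩
        rw [card_eq_card_mul_card_inf_ker (B.flip e) hw hwe, mul_comm,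
          ← card_level_one (B.flip e) hw hwe, ← Fintype.card_subtype, ← Nat.card_eq_fintype_card]
        rfl
      have hWcard : W.card = Nat.card F ^ (2 * n + 1) := by
        refine Nat.eq_of_mul_eq_mul_right hq ?_
        rw [hlevel K ⟨w, hw, hwe⟩, hn]; ring
      have hNcard : ∀ N ∈ (lagrangians B K).filter (fun N => e ∉ N),
          (W.filter fun w => w ∈ N).card = Nat.card F ^ n := by
        intro N hN
        obtain ⟨hN, heN⟩ := Finset.mem_filter.1 hN
        have hN := mem_lagrangians.1 hN
        have hex : ∃ w ∈ N, B w e = 1 := by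
          by_contra! h
          refine heN ((hN e).2 ⟨heK, fun m hm => ?_⟩)
          by_contra hne
          have hme : B m e ≠ 0 := fun h => hne (by rw [← hB.neg m e, h, neg_zero])
          exact h ((B m e)⁻¹ • m) (N.smul_mem _ hm) (by simp [hme])
        refine Nat.eq_of_mul_eq_mul_right hq ?_
        rw [← pow_succ, ← hN.card_eq hB hK hn, ← hlevel N hex, hW, Finset.filter_filter]
        congr 3
        ext w
        exact ⟨fun h => ⟨h.2, h.1.2⟩, fun h => ⟨⟨hN.le h.1, h.2⟩, h.1⟩⟩
      refine Nat.eq_of_mul_eq_mul_left (pow_pos hq n) ?_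
      calc Nat.card F ^ n * ∑ N ∈ lagrangians B K with e ∉ N, Nat.card (M ⊓ N : Submodule F V) ^ s
          = ∑ N ∈ lagrangians B K with e ∉ N, ∑ w ∈ W with w ∈ N,
              Nat.card (M ⊓ N : Submodule F V) ^ s := by
            rw [Finset.mul_sum]
            refine Finset.sum_congr rfl fun N hN => ?_
            rw [Finset.sum_const, hNcard N hN, smul_eq_mul]
        _ = ∑ w ∈ W, ∑ N ∈ lagrangians B K with w ∈ N, Nat.card (M ⊓ N : Submodule F V) ^ s := by
            refine Finset.sum_comm' fun N w => ?_
            simp only [Finset.mem_filter, hW, Finset.mem_univ, true_and]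
            constructor
            · tauto
            · rintro ⟨⟨hN, hwN⟩, hwK, hwe⟩
              refine ⟨⟨hN, fun heN => ?_⟩, ⟨hwK, hwe⟩, hwN⟩
              rw [(mem_lagrangians.1 hN).apply_eq_zero hwN heN] at hwe
              exact zero_ne_one hwe
        _ = ∑ w ∈ W, ∏ i ∈ Finset.range n, (Nat.card F ^ s + Nat.card F ^ (i + 1)) := by
            refine Finset.sum_congr rfl fun w hw => ?_
            obtain ⟨hwK, hwe⟩ := (Finset.mem_filter.1 hw).2
            rw [sum_lagrangians_through (w := e) hB hwK (by simp [hwe]), ← hih w hwK hwe,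
              planeComplement_comm]
            refine Finset.sum_congr rfl fun P hP => ?_
            rw [inf_sup_span_of_mem hM he (hne w hwe) (mem_lagrangians.1 hP).le]
        _ = _ := by
            rw [Finset.sum_const, hWcard, smul_eq_mul]; ring

end Lagrangian

/-! ### Displacement operators -/

section Displacement

variable {d n : ℕ} [Fact d.Prime]

/-- The displacement operator `(T(v) ψ)(y) = ω^{v_p · y} ψ(y - v_q)`, which is the Weyl operator
`w(v)` without its power of `τ`. Its phases depend on `v` only through `ℤ_d`. -/
def displacement (v : PhaseSpace d n) : Module.End ℂ (Hilb d n) where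
  toFun ψ := WithLp.toLp 2 fun y => ZMod.stdAddChar (v.1 ⬝ᵥ y) * ψ (y - v.2)
  map_add' ψ φ := by ext y; simp [mul_add]
  map_smul' a ψ := by ext y; simp [mul_left_comm]

@[simp] lemma displacement_apply (v : PhaseSpace d n) (ψ : Hilb d n) (y : Config d n) :
    displacement v ψ y = ZMod.stdAddChar (v.1 ⬝ᵥ y) * ψ (y - v.2) := rfl

lemma norm_stdAddChar (a : ZMod d) : ‖ZMod.stdAddChar a‖ = 1 := by
  rw [ZMod.stdAddChar_apply, Circle.norm_coe]

lemma stdAddChar_ne_zero (a : ZMod d) : ZMod.stdAddChar a ≠ (0 : ℂ) :=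
  norm_ne_zero_iff.1 (by rw [norm_stdAddChar]; exact one_ne_zero)

lemma conj_stdAddChar (a : ZMod d) :
    (starRingEnd ℂ) (ZMod.stdAddChar a) = ZMod.stdAddChar (-a) := by
  rw [AddChar.map_neg_eq_inv, Complex.inv_def, Complex.normSq_eq_norm_sq, norm_stdAddChar]
  simp

lemma stdAddChar_eq_one_iff {a : ZMod d} : ZMod.stdAddChar a = (1 : ℂ) ↔ a = 0 := by
  rw [← (ZMod.stdAddChar (N := d)).map_zero_eq_one, ZMod.injective_stdAddChar.eq_iff]

lemma stdAddChar_sum {ι : Type*} (s : Finset ι) (f : ι → ZMod d) :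
    (ZMod.stdAddChar (∑ i ∈ s, f i) : ℂ) = ∏ i ∈ s, ZMod.stdAddChar (f i) := by
  classical
  induction s using Finset.induction_on with
  | empty => simp
  | insert a s ha ih => rw [Finset.sum_insert ha, Finset.prod_insert ha, AddChar.map_add_eq_mul, ih]

lemma displacement_mul (u v : PhaseSpace d n) :
    displacement u * displacement v =
      (ZMod.stdAddChar (-(v.1 ⬝ᵥ u.2)) : ℂ) • displacement (u + v) := by
  ext ψ y
  simp only [Module.End.mul_apply, displacement_apply, LinearMap.smul_apply, PiLp.smul_apply,
    smul_eq_mul, Prod.fst_add, Prod.snd_add, dotProduct_sub, add_dotProduct, sub_sub]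
  rw [← mul_assoc, ← mul_assoc, ← AddChar.map_add_eq_mul, ← AddChar.map_add_eq_mul]
  congr 2
  ring

lemma displacement_zero : displacement (0 : PhaseSpace d n) = 1 := by
  ext ψ y
  simp

lemma symp_eq (u v : PhaseSpace d n) : symp u v = u.1 ⬝ᵥ v.2 - v.1 ⬝ᵥ u.2 := by
  rw [symp, dotProduct_comm u.2]

/-- Displacement operators commute up to the phase `ω^{[u, v]}`. -/
lemma displacement_mul_eq_smul (u v : PhaseSpace d n) :
    displacement u * displacement v =
      (ZMod.stdAddChar (symp u v) : ℂ) • (displacement v * displacement u) := by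
  rw [displacement_mul, displacement_mul, smul_smul, ← AddChar.map_add_eq_mul, symp_eq,
    add_comm u v]
  congr 2
  ring

lemma displacement_pow (v : PhaseSpace d n) (k : ℕ) :
    displacement v ^ k =
      (ZMod.stdAddChar (-((k.choose 2 : ZMod d) * (v.1 ⬝ᵥ v.2))) : ℂ) • displacement (k • v) := by
  induction k with
  | zero => simp [displacement_zero]
  | succ k ih =>
    rw [pow_succ, ih, smul_mul_assoc, displacement_mul, smul_smul, ← AddChar.map_add_eq_mul,
      succ_nsmul]
    congr 2
    rw [Nat.choose_succ_succ' k 1]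
    simp only [Nat.choose_one_right, Prod.smul_snd, dotProduct_smul, Nat.cast_add]
    rw [nsmul_eq_mul]
    ring

lemma inner_eq_sum (ψ φ : Hilb d n) :
    inner ℂ ψ φ = ∑ y, (starRingEnd ℂ) (ψ y) * φ y := by
  rw [PiLp.inner_apply]
  simp [mul_comm]

lemma inner_displacement_displacement (v : PhaseSpace d n) (ψ φ : Hilb d n) :
    inner ℂ (displacement v ψ) (displacement v φ) = inner ℂ ψ φ := by
  rw [inner_eq_sum, inner_eq_sum,
    ← Equiv.sum_comp (Equiv.subRight v.2) fun y => (starRingEnd ℂ) (ψ y) * φ y]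
  refine Finset.sum_congr rfl fun y _ => ?_
  simp only [displacement_apply, map_mul, conj_stdAddChar, Equiv.subRight_apply]
  have : (ZMod.stdAddChar (-(v.1 ⬝ᵥ y)) : ℂ) * ZMod.stdAddChar (v.1 ⬝ᵥ y) = 1 := by
    rw [← AddChar.map_add_eq_mul, neg_add_cancel, AddChar.map_zero_eq_one]
  linear_combination (starRingEnd ℂ) (ψ (y - v.2)) * φ (y - v.2) * this

lemma sum_stdAddChar_dotProduct (z : Config d n) :
    ∑ p : Config d n, (ZMod.stdAddChar (p ⬝ᵥ z) : ℂ) = if z = 0 then (d : ℂ) ^ n else 0 := by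
  have h : ∀ p : Config d n,
      (ZMod.stdAddChar (p ⬝ᵥ z) : ℂ) = ∏ i, ZMod.stdAddChar (p i * z i) := fun p => by
    rw [dotProduct, stdAddChar_sum]
  simp_rw [h]
  rw [← Fintype.prod_sum (fun i (a : ZMod d) => (ZMod.stdAddChar (a * z i) : ℂ))]
  simp_rw [AddChar.sum_mulShift _ (ZMod.isPrimitive_stdAddChar d), ZMod.card]
  split_ifs with hz
  · simp [hz]
  · obtain ⟨i, hi⟩ := Function.ne_iff.1 hz
    exact Finset.prod_eq_zero (Finset.mem_univ i) (by rw [if_neg (show ¬z i = 0 from hi), Nat.cast_zero])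

/-- The displacement operators form an orthogonal operator basis: the overlap of two vectors is
determined by their characteristic functions `v ↦ ⟨ψ, T(v) ψ⟩`. -/
lemma sum_inner_displacement (ψ φ : Hilb d n) :
    ∑ v, inner ℂ ψ (displacement v ψ) * (starRingEnd ℂ) (inner ℂ φ (displacement v φ)) =
      (d : ℂ) ^ n * (inner ℂ ψ φ * (starRingEnd ℂ) (inner ℂ ψ φ)) := by
  have hpt : ∀ v : PhaseSpace d n,
      inner ℂ ψ (displacement v ψ) * (starRingEnd ℂ) (inner ℂ φ (displacement v φ)) =
      ∑ y, ∑ z, ((starRingEnd ℂ) (ψ y) * ψ (y - v.2) * φ z * (starRingEnd ℂ) (φ (z - v.2))) *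
        ZMod.stdAddChar (v.1 ⬝ᵥ (y - z)) := by
    intro v
    simp only [inner_eq_sum, displacement_apply, map_sum, map_mul, conj_stdAddChar,
      Complex.conj_conj, Finset.sum_mul_sum]
    refine Finset.sum_congr rfl fun y _ => Finset.sum_congr rfl fun z _ => ?_
    rw [dotProduct_sub, sub_eq_add_neg (v.1 ⬝ᵥ y), AddChar.map_add_eq_mul]
    ring
  simp_rw [hpt]
  rw [Fintype.sum_prod_type_right]
  calc ∑ q : Config d n, ∑ p : Config d n, ∑ y, ∑ z, _
      = ∑ q : Config d n, ∑ y, ∑ z : Config d n, ((starRingEnd ℂ) (ψ y) * ψ (y - q) * φ z *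
          (starRingEnd ℂ) (φ (z - q))) * (if y - z = 0 then (d : ℂ) ^ n else 0) := by
        refine Finset.sum_congr rfl fun q _ => ?_
        rw [Finset.sum_comm]
        refine Finset.sum_congr rfl fun y _ => ?_
        rw [Finset.sum_comm]
        refine Finset.sum_congr rfl fun z _ => ?_
        rw [← sum_stdAddChar_dotProduct, Finset.mul_sum]
    _ = ∑ y, ∑ q : Config d n, (d : ℂ) ^ n * ((starRingEnd ℂ) (ψ y) * φ y) *
          (ψ (y - q) * (starRingEnd ℂ) (φ (y - q))) := by
        rw [Finset.sum_comm]
        refine Finset.sum_congr rfl fun y _ => Finset.sum_congr rfl fun q _ => ?_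
        simp only [sub_eq_zero, mul_ite, mul_zero, Finset.sum_ite_eq, Finset.mem_univ, if_true]
        ring
    _ = _ := by
        simp only [inner_eq_sum, map_sum, map_mul, Complex.conj_conj]
        rw [← mul_assoc, Finset.mul_sum Finset.univ (fun y => (starRingEnd ℂ) (ψ y) * φ y), Finset.sum_mul]
        refine Finset.sum_congr rfl fun y _ => ?_
        rw [← Finset.mul_sum]
        congr 1
        exact Equiv.sum_comp (Equiv.subLeft y) fun x => ψ x * (starRingEnd ℂ) (φ x)

/-! ### Weyl operators -/

lemma omega_eq : omega d = Complex.exp (2 * Real.pi * Complex.I / d) := by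
  have hd : (d : ℂ) ≠ 0 := Nat.cast_ne_zero.2 (NeZero.ne d)
  rw [omega, tau, ← Complex.exp_nat_mul]
  have : ((2 : ℕ) : ℂ) * (Real.pi * Complex.I * ((d : ℂ) ^ 2 + 1) / d) =
      2 * Real.pi * Complex.I / d + d * (2 * Real.pi * Complex.I) := by
    field_simp
    push_cast
    ring
  rw [this, Complex.exp_add, Complex.exp_nat_mul_two_pi_mul_I, mul_one]

lemma isPrimitiveRoot_omega : IsPrimitiveRoot (omega d) d := by
  rw [omega_eq]
  exact Complex.isPrimitiveRoot_exp d (NeZero.ne d)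

lemma omega_pow (k : ℕ) : omega d ^ k = ZMod.stdAddChar (k : ZMod d) := by
  have := ZMod.stdAddChar_coe (N := d) k
  rw [Int.cast_natCast] at this
  rw [this, omega_eq, ← Complex.exp_nat_mul]
  push_cast
  congr 1
  ring

lemma tau_pow_sq : tau d ^ (d ^ 2) = 1 := by
  have hd : (d : ℂ) ≠ 0 := Nat.cast_ne_zero.2 (NeZero.ne d)
  obtain ⟨k, hk⟩ : Even (d * (d ^ 2 + 1)) := by
    rcases Nat.even_or_odd d with h | h
    · exact h.mul_right _
    · exact (h.pow.add_one).mul_left _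
  have hk' : (d : ℂ) * (d ^ 2 + 1) = k + k := by exact_mod_cast hk
  rw [tau, ← Complex.exp_nat_mul]
  have : ((d ^ 2 : ℕ) : ℂ) * (Real.pi * Complex.I * ((d : ℂ) ^ 2 + 1) / d) =
      k * (2 * Real.pi * Complex.I) := by
    push_cast
    field_simp
    linear_combination hk'
  rw [this, Complex.exp_nat_mul_two_pi_mul_I]

/-- The phase `τ^{-p·q}` by which the Weyl operator `w(p, q)` differs from the displacement
operator. -/
def weylPhase (v : PhaseSpace d n) : ℂ :=
  ∏ i, tau d ^ (-(((v.1 i).val : ℤ) * ((v.2 i).val : ℤ)))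

omit [Fact d.Prime] in
lemma weylPhase_ne_zero (v : PhaseSpace d n) : weylPhase v ≠ 0 :=
  Finset.prod_ne_zero_iff.2 fun _ _ => zpow_ne_zero _ (Complex.exp_ne_zero _)

lemma weylPhase_pow_sq (v : PhaseSpace d n) : weylPhase v ^ (d ^ 2) = 1 := by
  rw [weylPhase, ← Finset.prod_pow]
  refine Finset.prod_eq_one fun i _ => ?_
  rw [← zpow_natCast, ← zpow_mul, mul_comm, zpow_mul, zpow_natCast, tau_pow_sq, one_zpow]

lemma weylPhase_sq (v : PhaseSpace d n) :
    weylPhase v ^ 2 = ZMod.stdAddChar (-(v.1 ⬝ᵥ v.2)) := by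
  rw [weylPhase, ← Finset.prod_pow, dotProduct, ← Finset.sum_neg_distrib, stdAddChar_sum]
  refine Finset.prod_congr rfl fun i _ => ?_
  rw [← zpow_natCast, ← zpow_mul, mul_comm, zpow_mul, zpow_natCast, ← omega, zpow_neg,
    AddChar.map_neg_eq_inv, ← Nat.cast_mul, zpow_natCast, omega_pow]
  simp

/-- The Weyl operator `w(v)` as an endomorphism of the Hilbert space. -/
def weylEnd (v : PhaseSpace d n) : Module.End ℂ (Hilb d n) := weylPhase v • displacement v

lemma weyl_mulVec (v : PhaseSpace d n) (ψ : Hilb d n) :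
    weyl d n v *ᵥ ψ.ofLp = (weylEnd v ψ).ofLp := by
  have hentry : ∀ y x, weyl d n v y x =
      weylPhase v * ZMod.stdAddChar (v.1 ⬝ᵥ y) * if x = y - v.2 then 1 else 0 := by
    intro y x
    have h1 : ∀ i, weylOne d (v.1 i) (v.2 i) (y i) (x i) =
        tau d ^ (-(((v.1 i).val : ℤ) * ((v.2 i).val : ℤ))) * ZMod.stdAddChar (v.1 i * y i) *
          if x i = y i - v.2 i then 1 else 0 := by
      intro i
      simp only [weylOne, boost, shift, Matrix.smul_apply, Matrix.diagonal_mul, Matrix.of_apply,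
        smul_eq_mul, omega_pow, Nat.cast_mul, ZMod.natCast_val, ZMod.cast_id', id_eq, mul_assoc,
        eq_sub_iff_add_eq, eq_comm]
    rw [weyl, Matrix.of_apply]
    simp_rw [h1]
    rw [Finset.prod_mul_distrib, Finset.prod_mul_distrib, ← weylPhase, dotProduct,
      stdAddChar_sum]
    congr 1
    split_ifs with h
    · exact Finset.prod_eq_one fun i _ => by simp [h]
    · obtain ⟨i, hi⟩ := Function.ne_iff.1 h
      exact Finset.prod_eq_zero (Finset.mem_univ i) (by simpa using hi)
  ext y
  simp [Matrix.mulVec, dotProduct, hentry, weylEnd, mul_assoc]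

lemma weylEnd_pow (v : PhaseSpace d n) : weylEnd v ^ d = 1 := by
  have hd : (d • v : PhaseSpace d n) = 0 := by
    rw [← Nat.cast_smul_eq_nsmul (ZMod d)]
    simp
  have h2 : d + 2 * d.choose 2 = d ^ 2 := by
    obtain ⟨k, hk⟩ := Nat.exists_eq_succ_of_ne_zero (NeZero.ne d)
    rw [hk, Nat.succ_eq_add_one, Nat.choose_two_right, Nat.add_sub_cancel,
      Nat.mul_div_cancel' (by rw [mul_comm]; exact (Nat.even_mul_succ_self k).two_dvd)]
    ring
  rw [weylEnd, smul_pow, displacement_pow, hd, displacement_zero, ← mul_neg, smul_smul,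
    ← nsmul_eq_mul, AddChar.map_nsmul_eq_pow, ← weylPhase_sq, ← pow_mul, ← pow_add, h2,
    weylPhase_pow_sq, one_smul]

end Displacement

section Isotropy

variable {d n : ℕ} [Fact d.Prime]

/-! ### Stabilizer states as joint eigenvectors -/

/-- The phase space points whose displacement operators have `ψ` as an eigenvector. -/
def isotropy (ψ : Hilb d n) : Submodule (ZMod d) (PhaseSpace d n) :=
  AddSubgroup.toZModSubmodule d
    { carrier := {v | ∃ a : ℂ, displacement v ψ = a • ψ}
      zero_mem' := ⟨1, by rw [displacement_zero]; simp⟩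
      add_mem' := by
        rintro u v ⟨a, ha⟩ ⟨b, hb⟩
        refine ⟨ZMod.stdAddChar (v.1 ⬝ᵥ u.2) * (a * b), ?_⟩
        have h := LinearMap.congr_fun (displacement_mul u v) ψ
        rw [Module.End.mul_apply, hb, map_smul, ha, LinearMap.smul_apply] at h
        rw [mul_smul, ← smul_smul, smul_comm a b, h, smul_smul, ← AddChar.map_add_eq_mul,
          add_neg_cancel, AddChar.map_zero_eq_one, one_smul]
      neg_mem' := by
        rintro v ⟨a, ha⟩
        have h := LinearMap.congr_fun (displacement_mul (-v) v) ψ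
        rw [neg_add_cancel, displacement_zero, Module.End.mul_apply, ha, map_smul,
          LinearMap.smul_apply, Module.End.one_apply] at h
        set b : ℂ := ZMod.stdAddChar (-(v.1 ⬝ᵥ (-v).2)) with hb
        have hb0 : b ≠ 0 := stdAddChar_ne_zero _
        by_cases h0 : a = 0
        · refine ⟨0, ?_⟩
          rw [h0, zero_smul] at h
          have : ψ = 0 := (smul_eq_zero.1 h.symm).resolve_left hb0
          rw [this, map_zero, smul_zero]
        · refine ⟨a⁻¹ * b, ?_⟩
          rw [mul_smul, ← h, smul_smul, inv_mul_cancel₀ h0, one_smul] }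

lemma mem_isotropy {ψ : Hilb d n} {v : PhaseSpace d n} :
    v ∈ isotropy ψ ↔ ∃ a : ℂ, displacement v ψ = a • ψ := Iff.rfl

lemma isotropy_smul {c : ℂ} (hc : c ≠ 0) (ψ : Hilb d n) : isotropy (c • ψ) = isotropy ψ := by
  ext v
  simp only [mem_isotropy, map_smul]
  refine exists_congr fun a => ?_
  rw [smul_comm a c]
  exact (smul_right_injective _ hc).eq_iff

lemma mem_isotropy_iff_weylEnd {ψ : Hilb d n} {v : PhaseSpace d n} :
    v ∈ isotropy ψ ↔ ∃ a : ℂ, weylEnd v ψ = a • ψ := by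
  constructor
  · rintro ⟨a, ha⟩
    exact ⟨weylPhase v * a, by rw [weylEnd, LinearMap.smul_apply, ha, smul_smul]⟩
  · rintro ⟨a, ha⟩
    refine ⟨(weylPhase v)⁻¹ * a, ?_⟩
    rw [mul_smul, ← ha, weylEnd, LinearMap.smul_apply, smul_smul,
      inv_mul_cancel₀ (weylPhase_ne_zero v), one_smul]

lemma norm_displacement (v : PhaseSpace d n) (ψ : Hilb d n) : ‖displacement v ψ‖ = ‖ψ‖ := by
  rw [@norm_eq_sqrt_re_inner ℂ, @norm_eq_sqrt_re_inner ℂ, inner_displacement_displacement]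

lemma norm_eigenvalue {ψ : Hilb d n} (hψ : ψ ≠ 0) {v : PhaseSpace d n} {a : ℂ}
    (h : displacement v ψ = a • ψ) : ‖a‖ = 1 := by
  have h1 := norm_displacement v ψ
  rw [h, norm_smul] at h1
  exact mul_right_cancel₀ (norm_ne_zero_iff.2 hψ) (h1.trans (one_mul _).symm)

/-- Displacement operators with a common eigenvector commute. -/
lemma symp_eq_zero_of_mem_isotropy {ψ : Hilb d n} (hψ : ψ ≠ 0) {u v : PhaseSpace d n}
    (hu : u ∈ isotropy ψ) (hv : v ∈ isotropy ψ) : symp u v = 0 := by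
  obtain ⟨a, ha⟩ := hu
  obtain ⟨b, hb⟩ := hv
  have h := LinearMap.congr_fun (displacement_mul_eq_smul u v) ψ
  rw [LinearMap.smul_apply, Module.End.mul_apply, Module.End.mul_apply, ha, hb, map_smul, map_smul,
    ha, hb, smul_smul, smul_smul, smul_smul] at h
  have h1 := smul_left_injective ℂ hψ h
  have ha0 : a ≠ 0 := norm_ne_zero_iff.1 (by rw [norm_eigenvalue hψ ha]; exact one_ne_zero)
  have hb0 : b ≠ 0 := norm_ne_zero_iff.1 (by rw [norm_eigenvalue hψ hb]; exact one_ne_zero)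
  refine stdAddChar_eq_one_iff.1 (mul_right_cancel₀ (mul_ne_zero ha0 hb0) ?_)
  rw [one_mul, ← mul_assoc]
  exact h1.symm.trans (mul_comm b a)

lemma IsLagrangian.eq_isotropy {M : Submodule (ZMod d) (PhaseSpace d n)} (hM : IsLagrangian M)
    {ψ : Hilb d n} (hψ : ψ ≠ 0) (h : M ≤ isotropy ψ) : M = isotropy ψ :=
  le_antisymm h fun v hv => (hM v).2 fun _ hm => symp_eq_zero_of_mem_isotropy hψ hv (h hm)

lemma prod_ofFn_mulVec {ι : Type*} [Fintype ι] [DecidableEq ι] {r : ℕ} (A : Fin r → Matrix ι ι ℂ)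
    (a : Fin r → ℂ) (ψ : ι → ℂ) (h : ∀ i, A i *ᵥ ψ = a i • ψ) :
    (List.ofFn A).prod *ᵥ ψ = (∏ i, a i) • ψ := by
  induction r with
  | zero => simp
  | succ r ih =>
    rw [List.ofFn_succ, List.prod_cons, ← Matrix.mulVec_mulVec, ih _ (fun i => a i.succ)
      (fun i => h i.succ), Matrix.mulVec_smul, h, smul_smul, Fin.prod_univ_succ, mul_comm]

lemma prod_ofFn_pow_single {R : Type*} [Monoid R] {r : ℕ} (A : Fin r → R) (i : Fin r) :
    (List.ofFn fun j => A j ^ (if j = i then 1 else 0)).prod = A i := by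
  induction r with
  | zero => exact i.elim0
  | succ r ih =>
    rw [List.ofFn_succ, List.prod_cons]
    refine Fin.cases ?_ (fun i => ?_) i
    · simp [Fin.succ_ne_zero]
    · simp only [Fin.succ_inj, (Fin.succ_ne_zero i).symm, if_false, pow_zero, one_mul]
      exact ih (fun j => A j.succ) i

lemma weylBasis_self {r : ℕ} {M : Submodule (ZMod d) (PhaseSpace d n)}
    (B : Module.Basis (Fin r) (ZMod d) M) (i : Fin r) : weylBasis B (B i) = weyl d n (B i) := by
  rw [weylBasis, ← prod_ofFn_pow_single (fun j => weyl d n (B j : PhaseSpace d n)) i]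
  have : Fact (1 < d) := ⟨(Fact.out : d.Prime).one_lt⟩
  congr 2
  ext1 j
  rw [Module.Basis.repr_self, Finsupp.single_apply]
  congr 1
  by_cases h : j = i
  · simp [h, ZMod.val_one]
  · simp [h, Ne.symm h]

/-- Every linear functional on the phase space is a symplectic product with a fixed vector. -/
lemma exists_symp_eq (f : PhaseSpace d n →ₗ[ZMod d] ZMod d) :
    ∃ v, ∀ u, symp v u = f u := by
  refine ⟨(fun j => f (0, Pi.single j 1), fun j => -f (Pi.single j 1, 0)), fun u => ?_⟩
  have h1 : ∀ x : Config d n, x = ∑ j, x j • Pi.single j (1 : ZMod d) := fun x => by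
    conv_lhs => rw [← Finset.univ_sum_single x]
    exact Finset.sum_congr rfl fun j _ => by rw [← Pi.single_smul, smul_eq_mul, mul_one]
  have h2 : f u = (f ∘ₗ LinearMap.inl (ZMod d) (Config d n) (Config d n)) u.1 +
      (f ∘ₗ LinearMap.inr (ZMod d) (Config d n) (Config d n)) u.2 := by
    simp [← map_add]
  rw [h2, h1 u.1, h1 u.2, map_sum, map_sum]
  simp only [map_smul, symp, dotProduct]
  simp [mul_comm, add_comm]

/-- A unit vector is a stabilizer vector exactly if it is a joint eigenvector of the displacement
operators of a Lagrangian subspace. The eigenvalues of the Weyl operators of a basis are `d`-th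
roots of unity, hence are matched by the characters `m ↦ ω^{[v, m]}`. -/
lemma isStabilizerVector_iff {ψ : Hilb d n} :
    IsStabilizerVector d n ψ ↔ ‖ψ‖ = 1 ∧
      ∃ M : Submodule (ZMod d) (PhaseSpace d n), IsLagrangian M ∧ M ≤ isotropy ψ := by
  refine and_congr_right fun hψ => ?_
  have hψ0 : ψ ≠ 0 := norm_ne_zero_iff.1 (by rw [hψ]; exact one_ne_zero)
  constructor
  · rintro ⟨M, r, B, v, hM, h⟩
    refine ⟨M, hM, fun m hm => ?_⟩
    have hB : ∀ i, (B i : PhaseSpace d n) ∈ isotropy ψ := by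
      intro i
      have hi := h (B i)
      rw [weylBasis_self, weyl_mulVec, omega_pow] at hi
      refine mem_isotropy_iff_weylEnd.2 ⟨(ZMod.stdAddChar
        ((symp v (B i : PhaseSpace d n)).val : ZMod d) : ℂ)⁻¹, ?_⟩
      have hi' : (ZMod.stdAddChar ((symp v (B i : PhaseSpace d n)).val : ZMod d) : ℂ) •
        weylEnd (B i : PhaseSpace d n) ψ = ψ := by
        ext y; exact congrFun hi y
      conv_rhs => rw [← hi']
      rw [smul_smul, inv_mul_cancel₀ (stdAddChar_ne_zero _), one_smul]
    have := congrArg Subtype.val (B.sum_repr ⟨m, hm⟩)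
    rw [← show _ = m from this, ← M.subtype_apply, map_sum]
    exact Submodule.sum_mem _ fun i _ => by
      rw [map_smul]; exact Submodule.smul_mem _ _ (hB i)
  · rintro ⟨M, hM, h⟩
    let B := Module.finBasis (ZMod d) M
    have h1 : ∀ i, ∃ c : ZMod d,
        weylEnd (B i : PhaseSpace d n) ψ = (ZMod.stdAddChar c : ℂ) • ψ := by
      intro i
      obtain ⟨a, ha⟩ := mem_isotropy_iff_weylEnd.1 (h (B i).2)
      have hpow : ∀ k : ℕ, (weylEnd (B i : PhaseSpace d n) ^ k) ψ = a ^ k • ψ := by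
        intro k
        induction k with
        | zero => simp
        | succ k ih => rw [pow_succ, Module.End.mul_apply, ha, map_smul, ih, smul_smul, pow_succ']
      have had : a ^ d = 1 := by
        have := hpow d
        rw [weylEnd_pow, Module.End.one_apply] at this
        exact smul_left_injective ℂ hψ0 (by simpa using this.symm)
      obtain ⟨k, -, hk⟩ := isPrimitiveRoot_omega.eq_pow_of_pow_eq_one had
      exact ⟨k, by rw [ha, ← hk, omega_pow]⟩
    choose c hc using h1
    obtain ⟨f, hf⟩ := LinearMap.exists_extend (B.constr (ZMod d) fun i => -c i)
    obtain ⟨v, hv⟩ := exists_symp_eq f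
    refine ⟨M, _, B, v, hM, fun m => ?_⟩
    have hvm : symp v m = -∑ i, B.repr m i * c i := by
      rw [hv, ← M.subtype_apply, ← LinearMap.comp_apply, hf, Module.Basis.constr_apply_fintype]
      simp [Module.Basis.equivFun_apply]
    have hA : ∀ i, (weyl d n (B i : PhaseSpace d n) ^ (B.repr m i).val) *ᵥ ψ.ofLp =
        (ZMod.stdAddChar (B.repr m i * c i) : ℂ) • ψ.ofLp := by
      intro i
      have hk : ∀ k : ℕ, (weyl d n (B i : PhaseSpace d n) ^ k) *ᵥ ψ.ofLp =
          (ZMod.stdAddChar ((k : ZMod d) * c i) : ℂ) • ψ.ofLp := by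
        intro k
        induction k with
        | zero => simp
        | succ k ih =>
          rw [pow_succ, ← Matrix.mulVec_mulVec, weyl_mulVec, hc, WithLp.ofLp_smul,
            Matrix.mulVec_smul, ih, smul_smul, ← AddChar.map_add_eq_mul]
          congr 2
          push_cast
          ring
      rw [hk, ZMod.natCast_zmod_val]
    rw [weylBasis, prod_ofFn_mulVec _ _ _ hA, omega_pow, ZMod.natCast_zmod_val, smul_smul,
      ← stdAddChar_sum, ← AddChar.map_add_eq_mul, hvm, neg_add_cancel, AddChar.map_zero_eq_one,
      one_smul]

/-- The states that are joint eigenstates of the displacement operators of `M`. The choice of the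
representative is immaterial, by `mk_mem_eigenstates`. -/
def eigenstates (M : Submodule (ZMod d) (PhaseSpace d n)) : Set (ℙ ℂ (Hilb d n)) :=
  {x | M ≤ isotropy x.rep}

lemma mk_mem_eigenstates {M : Submodule (ZMod d) (PhaseSpace d n)} {ψ : Hilb d n} (hψ : ψ ≠ 0) :
    Projectivization.mk ℂ ψ hψ ∈ eigenstates M ↔ M ≤ isotropy ψ := by
  obtain ⟨a, ha⟩ := Projectivization.exists_smul_eq_mk_rep ℂ ψ hψ
  rw [eigenstates, Set.mem_ofPred_eq, ← ha, Units.smul_def, isotropy_smul a.ne_zero]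

/-- The unit vector representing a state. -/
def unitRep (x : ℙ ℂ (Hilb d n)) : Hilb d n := (‖x.rep‖⁻¹ : ℂ) • x.rep

lemma overlap_eq (x y : ℙ ℂ (Hilb d n)) : overlap x y = ‖inner ℂ (unitRep x) (unitRep y)‖ := rfl

lemma norm_unitRep (x : ℙ ℂ (Hilb d n)) : ‖unitRep x‖ = 1 := by
  have := norm_ne_zero_iff.2 x.rep_nonzero
  rw [unitRep, norm_smul, norm_inv, Complex.norm_real, norm_norm, inv_mul_cancel₀ this]

lemma unitRep_ne_zero (x : ℙ ℂ (Hilb d n)) : unitRep x ≠ 0 :=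
  norm_ne_zero_iff.1 (by rw [norm_unitRep]; exact one_ne_zero)

lemma inv_norm_rep_ne_zero (x : ℙ ℂ (Hilb d n)) : (‖x.rep‖⁻¹ : ℂ) ≠ 0 :=
  inv_ne_zero (Complex.ofReal_ne_zero.2 (norm_ne_zero_iff.2 x.rep_nonzero))

lemma mk_unitRep (x : ℙ ℂ (Hilb d n)) : Projectivization.mk ℂ (unitRep x) (unitRep_ne_zero x) = x := by
  conv_rhs => rw [← x.mk_rep]
  exact (Projectivization.mk_eq_mk_iff' ..).2 ⟨_, rfl⟩

lemma isotropy_unitRep (x : ℙ ℂ (Hilb d n)) : isotropy (unitRep x) = isotropy x.rep :=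
  isotropy_smul (inv_norm_rep_ne_zero x) _

lemma mem_stabs_iff {x : ℙ ℂ (Hilb d n)} :
    x ∈ Stabs d n ↔
      ∃ M : Submodule (ZMod d) (PhaseSpace d n), IsLagrangian M ∧ x ∈ eigenstates M := by
  constructor
  · rintro ⟨ψ, hψ, h, rfl⟩
    obtain ⟨-, M, hM, hle⟩ := isStabilizerVector_iff.1 h
    exact ⟨M, hM, (mk_mem_eigenstates hψ).2 hle⟩
  · rintro ⟨M, hM, hx⟩
    refine ⟨unitRep x, unitRep_ne_zero x, isStabilizerVector_iff.2 ⟨norm_unitRep x, M, hM, ?_⟩,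
      (mk_unitRep x).symm⟩
    rw [isotropy_unitRep]
    exact hx

end Isotropy

section Overlap

variable {d n : ℕ} [Fact d.Prime]

/-! ### Overlaps of stabilizer states -/

lemma inner_displacement_of_eq {ψ : Hilb d n} (hψ : ‖ψ‖ = 1) {v : PhaseSpace d n} {a : ℂ}
    (h : displacement v ψ = a • ψ) : inner ℂ ψ (displacement v ψ) = a := by
  rw [h, inner_smul_right, inner_self_eq_norm_sq_to_K, hψ]
  simp

/-- The characteristic function of a stabilizer vector vanishes off its Lagrangian subspace: some
displacement operator that fixes the vector up to a phase shifts the phase of `T(v)`. -/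
lemma inner_displacement_eq_zero {M : Submodule (ZMod d) (PhaseSpace d n)} (hM : IsLagrangian M)
    {ψ : Hilb d n} (hψ : ‖ψ‖ = 1) (h : M ≤ isotropy ψ) {v : PhaseSpace d n} (hv : v ∉ M) :
    inner ℂ ψ (displacement v ψ) = 0 := by
  have hψ0 : ψ ≠ 0 := norm_ne_zero_iff.1 (by rw [hψ]; exact one_ne_zero)
  rw [hM v] at hv
  push Not at hv
  obtain ⟨m, hm, hne⟩ := hv
  obtain ⟨a, ha⟩ := h hm
  have hcomm := LinearMap.congr_fun (displacement_mul_eq_smul v m) ψ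
  rw [LinearMap.smul_apply, Module.End.mul_apply, Module.End.mul_apply, ha, map_smul] at hcomm
  have h1 := inner_displacement_displacement m ψ (displacement v ψ)
  have h2 : (ZMod.stdAddChar (symp v m) : ℂ) * inner ℂ ψ (displacement v ψ) =
      inner ℂ ψ (displacement v ψ) := by
    conv_lhs => rw [← h1]
    rw [← inner_smul_right, ← hcomm, ha, inner_smul_left, inner_smul_right, ← mul_assoc,
      ← Complex.normSq_eq_conj_mul_self, Complex.normSq_eq_norm_sq, norm_eigenvalue hψ0 ha]
    simp
  by_contra h0
  exact hne (stdAddChar_eq_one_iff.1 (mul_right_cancel₀ h0 (h2.trans (one_mul _).symm)))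

/-- On the intersection of the two Lagrangian subspaces, the product of one characteristic function
and the conjugate of the other is a character, because their cocycles cancel. Hence the sum of these
products is `0` or the size of the intersection. -/
lemma sq_norm_inner_eq {M N : Submodule (ZMod d) (PhaseSpace d n)} (hM : IsLagrangian M)
    (hN : IsLagrangian N) {ψ φ : Hilb d n} (hψ : ‖ψ‖ = 1) (hφ : ‖φ‖ = 1) (hMψ : M ≤ isotropy ψ)
    (hNφ : N ≤ isotropy φ) :
    ‖inner ℂ ψ φ‖ ^ 2 = 0 ∨
      ‖inner ℂ ψ φ‖ ^ 2 = (Nat.card (M ⊓ N : Submodule (ZMod d) (PhaseSpace d n)) : ℝ) / d ^ n := by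
  classical
  have hd : (d : ℂ) ^ n ≠ 0 := pow_ne_zero _ (Nat.cast_ne_zero.2 (NeZero.ne d))
  have hψ0 : ψ ≠ 0 := norm_ne_zero_iff.1 (by rw [hψ]; exact one_ne_zero)
  have hφ0 : φ ≠ 0 := norm_ne_zero_iff.1 (by rw [hφ]; exact one_ne_zero)
  set g : PhaseSpace d n → ℂ := fun v =>
    inner ℂ ψ (displacement v ψ) * (starRingEnd ℂ) (inner ℂ φ (displacement v φ)) with hg
  have hmul : ∀ {χ : Hilb d n}, ‖χ‖ = 1 → ∀ {u v : PhaseSpace d n}, u ∈ isotropy χ →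
      v ∈ isotropy χ → inner ℂ χ (displacement u χ) * inner ℂ χ (displacement v χ) =
        ZMod.stdAddChar (-(v.1 ⬝ᵥ u.2)) * inner ℂ χ (displacement (u + v) χ) := by
    rintro χ hχ u v ⟨a, ha⟩ ⟨b, hb⟩
    have h := LinearMap.congr_fun (displacement_mul u v) χ
    rw [Module.End.mul_apply, hb, map_smul, ha, LinearMap.smul_apply, smul_smul] at h
    rw [inner_displacement_of_eq hχ ha, inner_displacement_of_eq hχ hb, ← inner_smul_right, ← h,
      inner_smul_right, inner_self_eq_norm_sq_to_K, hχ]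
    simp [mul_comm]
  let χ : AddChar (M ⊓ N : Submodule (ZMod d) (PhaseSpace d n)) ℂ :=
    { toFun := fun v => g v
      map_zero_eq_one' := by
        have h1 : ∀ {χ : Hilb d n}, ‖χ‖ = 1 →
            inner ℂ χ (displacement (0 : PhaseSpace d n) χ) = 1 := fun hχ =>
          inner_displacement_of_eq hχ (by rw [displacement_zero]; simp)
        simp only [hg, Submodule.coe_zero, h1 hψ, h1 hφ, map_one, mul_one]
      map_add_eq_mul' := by
        rintro ⟨u, hu⟩ ⟨v, hv⟩
        have h1 := hmul hψ (hMψ hu.1) (hMψ hv.1)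
        have h2 := congrArg (starRingEnd ℂ) (hmul hφ (hNφ hu.2) (hNφ hv.2))
        rw [map_mul, map_mul, conj_stdAddChar, neg_neg] at h2
        have h3 : (ZMod.stdAddChar (-(v.1 ⬝ᵥ u.2)) : ℂ) * ZMod.stdAddChar (v.1 ⬝ᵥ u.2) = 1 := by
          rw [← AddChar.map_add_eq_mul, neg_add_cancel, AddChar.map_zero_eq_one]
        have h4 := congrArg₂ (· * ·) h1 h2
        simp only [hg, Submodule.coe_add] at h4 ⊢
        linear_combination -h4 - inner ℂ ψ (displacement (u + v) ψ) *
          (starRingEnd ℂ) (inner ℂ φ (displacement (u + v) φ)) * h3 }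
  have hsum : ∑ v, g v = ∑ v : (M ⊓ N : Submodule (ZMod d) (PhaseSpace d n)), χ v := by
    rw [← Finset.sum_filter_of_ne (p := fun v => v ∈ M ⊓ N)]
    · exact Finset.sum_subtype _ (fun v => by simp) g
    · intro v _ hv
      by_contra hMN
      refine hv ?_
      by_cases hvM : v ∈ M
      · rw [hg]
        dsimp only
        rw [inner_displacement_eq_zero hN hφ hNφ fun h => hMN ⟨hvM, h⟩, map_zero, mul_zero]
      · rw [hg]
        dsimp only
        rw [inner_displacement_eq_zero hM hψ hMψ hvM, zero_mul]
  have hpars := sum_inner_displacement ψ φ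
  rw [Complex.mul_conj, Complex.normSq_eq_norm_sq] at hpars
  change ∑ v, g v = _ at hpars
  rw [hsum, AddChar.sum_eq_ite] at hpars
  split_ifs at hpars with h0
  · right
    rw [eq_div_iff (pow_ne_zero _ (Nat.cast_ne_zero.2 (NeZero.ne d))), Nat.card_eq_fintype_card,
      mul_comm]
    exact_mod_cast hpars.symm
  · left
    have := (mul_eq_zero.1 hpars.symm).resolve_left hd
    exact_mod_cast this

/-! ### The phase space as a symplectic space -/

variable (d n) in
/-- The symplectic form of the phase space as a bilinear map. -/
def sympForm : PhaseSpace d n →ₗ[ZMod d] PhaseSpace d n →ₗ[ZMod d] ZMod d :=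
  LinearMap.mk₂ (ZMod d) symp
    (fun u u' v => by simp [symp, add_dotProduct]; ring)
    (fun a u v => by simp [symp, smul_dotProduct, mul_sub])
    (fun u v v' => by simp [symp, dotProduct_add]; ring)
    (fun a u v => by simp [symp, dotProduct_smul, mul_sub])

@[simp] lemma sympForm_apply (u v : PhaseSpace d n) : sympForm d n u v = symp u v := rfl

lemma sympForm_isAlt : (sympForm d n).IsAlt := fun v => by
  simp [symp, dotProduct_comm]

lemma isNondegenerateOn_sympForm : IsNondegenerateOn (sympForm d n) ⊤ := by
  intro v _ h
  ext j
  · simpa [symp] using h (0, Pi.single j 1) trivial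
  · simpa [symp] using h (Pi.single j 1, 0) trivial

lemma isLagrangianIn_sympForm {M : Submodule (ZMod d) (PhaseSpace d n)} :
    IsLagrangianIn (sympForm d n) ⊤ M ↔ IsLagrangian M := by
  simp [IsLagrangianIn, IsLagrangian]

lemma card_phaseSpace :
    Nat.card (⊤ : Submodule (ZMod d) (PhaseSpace d n)) = Nat.card (ZMod d) ^ (2 * n) := by
  rw [Nat.card_congr Submodule.topEquiv.toEquiv, Nat.card_prod]
  simp [← pow_add, two_mul]

lemma IsLagrangian.card_eq {M : Submodule (ZMod d) (PhaseSpace d n)} (hM : IsLagrangian M) :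
    Nat.card M = d ^ n := by
  have := (isLagrangianIn_sympForm.2 hM).card_eq sympForm_isAlt isNondegenerateOn_sympForm
    card_phaseSpace
  rwa [Nat.card_zmod] at this

lemma exists_isLagrangian : ∃ M : Submodule (ZMod d) (PhaseSpace d n), IsLagrangian M := by
  refine ⟨Submodule.prod ⊤ ⊥, fun v => ⟨?_, fun h => ?_⟩⟩
  · rintro ⟨-, hv⟩ m ⟨-, hm⟩
    have hv : v.2 = 0 := hv
    have hm : m.2 = 0 := hm
    simp [symp, hv, hm]
  · refine ⟨trivial, ?_⟩
    change v.2 = 0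
    ext j
    simpa [symp] using h (Pi.single j 1, 0) ⟨trivial, rfl⟩

/-! ### The eigenbasis of a Lagrangian subspace -/

variable {M N : Submodule (ZMod d) (PhaseSpace d n)}

lemma overlap_sq (hM : IsLagrangian M) (hN : IsLagrangian N) {x y : ℙ ℂ (Hilb d n)}
    (hx : x ∈ eigenstates M) (hy : y ∈ eigenstates N) :
    overlap x y ^ 2 = 0 ∨ overlap x y ^ 2 =
      (Nat.card (M ⊓ N : Submodule (ZMod d) (PhaseSpace d n)) : ℝ) / d ^ n :=
  sq_norm_inner_eq hM hN (norm_unitRep x) (norm_unitRep y) ((isotropy_unitRep x).symm ▸ hx)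
    ((isotropy_unitRep y).symm ▸ hy)

lemma overlap_eq_zero_of_ne (hM : IsLagrangian M) {x y : ℙ ℂ (Hilb d n)}
    (hx : x ∈ eigenstates M) (hy : y ∈ eigenstates M) (hxy : x ≠ y) : overlap x y = 0 := by
  have hd : (d : ℝ) ^ n ≠ 0 := pow_ne_zero _ (Nat.cast_ne_zero.2 (NeZero.ne d))
  refine pow_eq_zero_iff two_ne_zero |>.1 ((overlap_sq hM hM hx hy).resolve_right fun h => hxy ?_)
  rw [inf_idem, hM.card_eq, Nat.cast_pow, div_self hd, pow_eq_one_iff_of_nonneg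
    (show 0 ≤ overlap x y from norm_nonneg _) two_ne_zero,
    overlap_eq] at h
  -- Equality in the Cauchy-Schwarz inequality.
  have h1 := (norm_inner_eq_norm_iff (𝕜 := ℂ) (unitRep_ne_zero x) (unitRep_ne_zero y)).1
    (by rw [h, norm_unitRep, norm_unitRep, one_mul])
  obtain ⟨r, -, hr⟩ := h1
  rw [← mk_unitRep x, ← mk_unitRep y]
  exact ((Projectivization.mk_eq_mk_iff' ..).2 ⟨r, hr.symm⟩).symm

lemma orthonormal_unitRep (hM : IsLagrangian M) :
    Orthonormal ℂ fun x : eigenstates M => unitRep (x : ℙ ℂ (Hilb d n)) :=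
  ⟨fun _ => norm_unitRep _, fun _ y hxy => norm_eq_zero.1
    (overlap_eq_zero_of_ne hM (Subtype.property _) y.2 fun h => hxy (Subtype.ext h))⟩

lemma isSemisimple_weylEnd (v : PhaseSpace d n) : (weylEnd v).IsSemisimple := by
  refine Module.End.isSemisimple_of_squarefree_aeval_eq_zero (p := Polynomial.X ^ d - 1) ?_ ?_
  · exact (Polynomial.separable_X_pow_sub_C (1 : ℂ) (Nat.cast_ne_zero.2 (NeZero.ne d))
      one_ne_zero).squarefree
  · simp [weylEnd_pow]

/-- The Weyl operators of a Lagrangian subspace commute, and each is semisimple because its `d`-th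
power is the identity. Hence they are simultaneously diagonalizable. -/
lemma span_unitRep_eigenstates (hM : IsLagrangian M) :
    Submodule.span ℂ (Set.range fun x : eigenstates M => unitRep (x : ℙ ℂ (Hilb d n))) = ⊤ := by
  have hcomm : Pairwise fun u v : M =>
      Commute (weylEnd (u : PhaseSpace d n)) (weylEnd (v : PhaseSpace d n)) := by
    intro u v _
    refine Commute.smul_left (Commute.smul_right ?_ _) _
    rw [Commute, SemiconjBy, displacement_mul_eq_smul, (hM u).1 u.2 v v.2,
      AddChar.map_zero_eq_one, one_smul]
  have htop := Module.End.iSup_iInf_maxGenEigenspace_eq_top_of_iSup_maxGenEigenspace_eq_top_of_commute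
    (fun u : M => weylEnd (u : PhaseSpace d n)) hcomm
    fun _ => Module.End.iSup_maxGenEigenspace_eq_top _
  rw [eq_top_iff, ← htop]
  refine iSup_le fun a ψ hψ => ?_
  by_cases h0 : ψ = 0
  · rw [h0]; exact zero_mem _
  have hle : M ≤ isotropy ψ := by
    intro m hm
    have h := (Submodule.mem_iInf _).1 hψ ⟨m, hm⟩
    rw [(isSemisimple_weylEnd m).isFinitelySemisimple.maxGenEigenspace_eq_eigenspace] at h
    exact mem_isotropy_iff_weylEnd.2 ⟨_, Module.End.mem_eigenspace_iff.1 h⟩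
  have hmk := (Projectivization.mk_eq_mk_iff' ℂ ψ _ h0 (unitRep_ne_zero _)).1
    (mk_unitRep (Projectivization.mk ℂ ψ h0)).symm
  obtain ⟨c, hc⟩ := hmk
  rw [← hc]
  exact Submodule.smul_mem _ _
    (Submodule.subset_span ⟨⟨_, (mk_mem_eigenstates h0).2 hle⟩, rfl⟩)

lemma finite_eigenstates (hM : IsLagrangian M) : (eigenstates M).Finite :=
  Set.finite_coe_iff.1 (orthonormal_unitRep hM).linearIndependent.finite

/-- The states of the Lagrangian subspace `M` as a finite set, and `∅` if `M` is not Lagrangian. -/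
def eigenstatesFinset (M : Submodule (ZMod d) (PhaseSpace d n)) : Finset (ℙ ℂ (Hilb d n)) :=
  open Classical in if hM : IsLagrangian M then (finite_eigenstates hM).toFinset else ∅

lemma mem_eigenstatesFinset (hM : IsLagrangian M) {x : ℙ ℂ (Hilb d n)} :
    x ∈ eigenstatesFinset M ↔ x ∈ eigenstates M := by
  simp [eigenstatesFinset, hM]

lemma card_eigenstatesFinset (hM : IsLagrangian M) : (eigenstatesFinset M).card = d ^ n := by
  have : Fintype (eigenstates M) := (finite_eigenstates hM).fintype
  have h := Module.finrank_eq_card_basis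
    (OrthonormalBasis.mk (orthonormal_unitRep hM) (span_unitRep_eigenstates hM).ge).toBasis
  rw [finrank_euclideanSpace, Fintype.card_fun, ZMod.card, Fintype.card_fin] at h
  rw [h, ← Set.toFinset_card]
  congr 1
  ext x
  simp [mem_eigenstatesFinset hM]

lemma sum_overlap_sq (hM : IsLagrangian M) (x : ℙ ℂ (Hilb d n)) :
    ∑ y ∈ eigenstatesFinset M, overlap x y ^ 2 = 1 := by
  have : Fintype (eigenstates M) := (finite_eigenstates hM).fintype
  have h := (OrthonormalBasis.mk (orthonormal_unitRep hM)
    (span_unitRep_eigenstates hM).ge).sum_sq_norm_inner_left (unitRep x)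
  rw [norm_unitRep, one_pow] at h
  rw [← h, Finset.sum_subtype (p := fun y => y ∈ eigenstates M) (F := this) (eigenstatesFinset M)
    (fun y => mem_eigenstatesFinset hM)]
  simp [overlap_eq]

/-- Each nonzero squared overlap of `x` with the orthonormal basis of states of `N` has the same
value `|M ∩ N| / d^n`, and the squared overlaps sum to `1`. -/
lemma sum_overlap_pow (hM : IsLagrangian M) (hN : IsLagrangian N) {x : ℙ ℂ (Hilb d n)}
    (hx : x ∈ eigenstates M) (s : ℕ) :
    ∑ y ∈ eigenstatesFinset N, overlap x y ^ (2 * (s + 1)) =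
      ((Nat.card (M ⊓ N : Submodule (ZMod d) (PhaseSpace d n)) : ℝ) / d ^ n) ^ s := by
  rw [← mul_one ((_ : ℝ) ^ s), ← sum_overlap_sq hN x, Finset.mul_sum]
  refine Finset.sum_congr rfl fun y hy => ?_
  rw [pow_mul, pow_succ]
  rcases overlap_sq hM hN hx ((mem_eigenstatesFinset hN).1 hy) with h | h
  · rw [h, mul_zero, mul_zero]
  · rw [h]

/-! ### The frame potential -/

open Classical in
variable (d n) in
/-- The stabilizer states as a finite set. -/
def stabsFinset : Finset (ℙ ℂ (Hilb d n)) :=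
  (lagrangians (sympForm d n) ⊤).biUnion eigenstatesFinset

lemma mem_lagrangians_sympForm : M ∈ lagrangians (sympForm d n) ⊤ ↔ IsLagrangian M :=
  mem_lagrangians.trans isLagrangianIn_sympForm

lemma coe_stabsFinset : (stabsFinset d n : Set (ℙ ℂ (Hilb d n))) = Stabs d n := by
  ext x
  simp only [stabsFinset, Finset.coe_biUnion, Set.mem_iUnion, mem_stabs_iff, exists_prop,
    Finset.mem_coe, mem_lagrangians_sympForm]
  exact exists_congr fun M => and_congr_right fun hM => mem_eigenstatesFinset hM

/-- The sum splits over the Lagrangian subspaces, because a stabilizer state determines its subspace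
as the isotropy of its representative. -/
lemma sum_stabsFinset (f : ℙ ℂ (Hilb d n) → ℝ) :
    ∑ x ∈ stabsFinset d n, f x =
      ∑ M ∈ lagrangians (sympForm d n) ⊤, ∑ x ∈ eigenstatesFinset M, f x := by
  classical
  refine Finset.sum_biUnion fun M hM N hN hMN => Finset.disjoint_left.2 fun x hx hx' => hMN ?_
  have hM := mem_lagrangians_sympForm.1 hM
  have hN := mem_lagrangians_sympForm.1 hN
  rw [hM.eq_isotropy x.rep_nonzero ((mem_eigenstatesFinset hM).1 hx),
    hN.eq_isotropy x.rep_nonzero ((mem_eigenstatesFinset hN).1 hx')]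

lemma sum_card_inf_pow_sympForm (hM : IsLagrangian M) (s : ℕ) :
    ∑ N ∈ lagrangians (sympForm d n) ⊤,
        Nat.card (M ⊓ N : Submodule (ZMod d) (PhaseSpace d n)) ^ s =
      ∏ i ∈ Finset.range n, (d ^ s + d ^ (i + 1)) := by
  rw [sum_card_inf_pow sympForm_isAlt s isNondegenerateOn_sympForm card_phaseSpace
    (isLagrangianIn_sympForm.2 hM), Nat.card_zmod]

lemma card_lagrangians_sympForm :
    (lagrangians (sympForm d n) ⊤).card = ∏ i ∈ Finset.range n, (1 + d ^ (i + 1)) := by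
  obtain ⟨M, hM⟩ := exists_isLagrangian (d := d) (n := n)
  simpa using sum_card_inf_pow_sympForm hM 0

/-- The closed form of the frame potential, in which the numerators come from the `s`-th moment of
`|M ∩ N|` over the Lagrangian subspaces `N` and the factors `1 + d^(i+1)` from their number. -/
theorem framePotential_stabs (s : ℕ) :
    framePotential (s + 1) (Stabs d n) =
      ∏ i ∈ Finset.range n, ((d : ℝ) ^ s + d ^ (i + 1)) / (d ^ (s + 1) * (1 + d ^ (i + 1))) := by
  have hd : (0 : ℝ) < d := Nat.cast_pos.2 (NeZero.pos d)
  set L : ℝ := ∏ i ∈ Finset.range n, (1 + (d : ℝ) ^ (i + 1)) with hL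
  set Z : ℝ := ∏ i ∈ Finset.range n, ((d : ℝ) ^ s + (d : ℝ) ^ (i + 1)) with hZ
  have hL0 : 0 < L := Finset.prod_pos fun i _ => by positivity
  have hcardL : ((lagrangians (sympForm d n) ⊤).card : ℝ) = L := by
    rw [card_lagrangians_sympForm]; push_cast; rfl
  have hcard : ((stabsFinset d n).card : ℝ) = L * d ^ n := by
    rw [Finset.cast_card, sum_stabsFinset, ← hcardL, ← nsmul_eq_mul, ← Finset.sum_const]
    refine Finset.sum_congr rfl fun M hM => ?_
    rw [← Finset.cast_card, card_eigenstatesFinset (mem_lagrangians_sympForm.1 hM), Nat.cast_pow]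
  have hsum : ∑ x ∈ stabsFinset d n, ∑ y ∈ stabsFinset d n, overlap x y ^ (2 * (s + 1)) =
      L * (d ^ n * (Z / (d ^ n) ^ s)) := by
    rw [sum_stabsFinset, ← hcardL, ← nsmul_eq_mul, ← Finset.sum_const]
    refine Finset.sum_congr rfl fun M hM => ?_
    have hM := mem_lagrangians_sympForm.1 hM
    rw [← Nat.cast_pow, ← card_eigenstatesFinset hM, ← nsmul_eq_mul, ← Finset.sum_const,
      card_eigenstatesFinset hM]
    refine Finset.sum_congr rfl fun x hx => ?_
    rw [sum_stabsFinset, Finset.sum_congr rfl fun N hN => sum_overlap_pow hM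
      (mem_lagrangians_sympForm.1 hN) ((mem_eigenstatesFinset hM).1 hx) s]
    simp_rw [div_pow]
    rw [← Finset.sum_div, Nat.cast_pow]
    congr 1
    rw [hZ]
    exact_mod_cast sum_card_inf_pow_sympForm hM s
  rw [framePotential, ← coe_stabsFinset, Set.ncard_coe_finset, finsum_mem_coe_finset]
  simp_rw [finsum_mem_coe_finset]
  rw [hsum, hcard, Finset.prod_div_distrib, Finset.prod_mul_distrib, ← hZ, ← hL, Finset.prod_const,
    Finset.card_range, ← pow_mul, ← pow_mul]
  field_simp
  ring

end Overlap

end StabilizerStates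

end

theorem mainTheorem1 (d : ℕ) [Fact d.Prime] (t : ℕ) (ht : 1 ≤ t) :
    (∀ n : ℕ, 1 ≤ n → (StabilizerStates.Stabs d n).Finite ∧ (StabilizerStates.Stabs d n).Nonempty) ∧
    StabilizerStates.framePotential t (StabilizerStates.Stabs d 1) =
      ((d : ℝ) ^ ((2 : ℤ) - (t : ℤ)) + 1) / (((d : ℝ) + 1) * (d : ℝ)) ∧
    ∀ n : ℕ, 1 ≤ n →
      StabilizerStates.framePotential t (StabilizerStates.Stabs d (n + 1)) /
          StabilizerStates.framePotential t (StabilizerStates.Stabs d n) =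
        ((d : ℝ) ^ ((n : ℤ) - ((t : ℤ) - 2)) + 1) / ((d : ℝ) * ((d : ℝ) ^ (n + 1) + 1)) := by
  have hd : (0 : ℝ) < d := Nat.cast_pos.2 (NeZero.pos d)
  obtain ⟨s, rfl⟩ : ∃ s, t = s + 1 := ⟨t - 1, by omega⟩
  have hfactor : ∀ n : ℕ,
      ((d : ℝ) ^ s + (d : ℝ) ^ (n + 1)) / ((d : ℝ) ^ (s + 1) * (1 + (d : ℝ) ^ (n + 1))) =
        ((d : ℝ) ^ ((n : ℤ) - (((s + 1 : ℕ) : ℤ) - 2)) + 1) /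
          ((d : ℝ) * ((d : ℝ) ^ (n + 1) + 1)) := by
    intro n
    have : (n : ℤ) - (((s + 1 : ℕ) : ℤ) - 2) = ((n + 1 : ℕ) : ℤ) - (s : ℤ) := by
      push_cast; ring
    rw [this, zpow_sub₀ hd.ne', zpow_natCast, zpow_natCast]
    field_simp
    ring
  refine ⟨fun n _ => ⟨?_, ?_⟩, ?_, fun n _ => ?_⟩
  · rw [← StabilizerStates.coe_stabsFinset]
    exact Finset.finite_toSet _
  · obtain ⟨M, hM⟩ := StabilizerStates.exists_isLagrangian (d := d) (n := n)
    obtain ⟨x, hx⟩ := Finset.card_pos.1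
      ((StabilizerStates.card_eigenstatesFinset hM).symm ▸ pow_pos (NeZero.pos d) n)
    exact ⟨x, StabilizerStates.mem_stabs_iff.2
      ⟨M, hM, (StabilizerStates.mem_eigenstatesFinset hM).1 hx⟩⟩
  · rw [StabilizerStates.framePotential_stabs, Finset.prod_range_one, hfactor 0]
    congr 1
    · congr 2
      push_cast; ring
    · ring
  · rw [StabilizerStates.framePotential_stabs, StabilizerStates.framePotential_stabs,
      Finset.prod_range_succ, mul_div_cancel_left₀ _ (Finset.prod_pos fun i _ => by positivity).ne',
      hfactor n]
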